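/- Let $\Omega\subseteq\mathbb R^d$ be open and let $u\in BV(\Omega)$ be real-valued, i.e. $u\in L_1(\Omega)$ and its total variation $$|Du|(\Omega)=\sup\Big\{\int_\Omega u\,\operatorname{div}\psi\,dx:\ \psi\in C_c^1(\Omega;\mathbb R^d),\ |\psi|\le 1\Big\}$$ is finite; put $\|u\|_{BV(\Omega)}=\|u\|_{L_1(\Omega)}+|Du|(\Omega)$. Let $\phi,\varphi:\Omega\to\Omega$, and let $\Phi^s:\Omega\to\Omega$, $0\le s\le 1$, be maps with $\Phi^0=\phi$ and $\Phi^1=\varphi$. Assume that for every fixed $s\in[0,1]$ the map $\Phi^s$ is a $C^1$ diffeomorphism of $\Omega$ onto $\Omega$, that for every $x\in\Omega$ the map $s\mapsto\Phi^s(x)$ is differentiable on $[0,1]$ (one-sidedly at the end points), and that for constants $c,C\ge 0$ $$|\det D_x(\Phi^s)^{-1}(x)|\le c\quad\text{for all }x\in\Omega,\ 0\le s\le 1,$$ $$\sup_{0\le s\le 1,\ x\in\Omega}|\partial_s\Phi^s(x)|\le C\,\|\phi-\varphi\|_{L_\infty(\Omega)}.$$ Then $u\circ\phi-u\circ\varphi\in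 L_1(\Omega)$ and $$\|u\circ\phi-u\circ\varphi\|_{L_1(\Omega)}\le c\,C\,|Du|(\Omega)\,\|\phi-\varphi\|_{L_\infty(\Omega)},$$ and in particular $$\|u\circ\phi-u\circ\varphi\|_{L_1(\Omega)}\le c\,C\,\|u\|_{BV(\Omega)}\,\|\phi-\varphi\|_{L_\infty(\Omega)}.$$ Here $\|\phi-\varphi\|_{L_\infty(\Omega)}$ is allowed to be $+\infty$, with the convention $0\cdot\infty=0$. -/

import Mathlib

open MeasureTheory Set
open scoped ENNReal NNReal

noncomputable section

/-- The divergence `∑ i, ∂ᵢ ψᵢ` of a vector field `ψ` on `ℝᵈ`. -/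
def divergence {d : ℕ} (ψ : EuclideanSpace ℝ (Fin d) → EuclideanSpace ℝ (Fin d))
    (x : EuclideanSpace ℝ (Fin d)) : ℝ :=
  ∑ i, (fderiv ℝ ψ x (EuclideanSpace.single i 1)) i

/-- The vector fields admissible in the definition of the total variation: continuously
differentiable, with compact support inside `Ω`, and of Euclidean length at most one. -/
def IsTestField {d : ℕ} (Ω : Set (EuclideanSpace ℝ (Fin d)))
    (ψ : EuclideanSpace ℝ (Fin d) → EuclideanSpace ℝ (Fin d)) : Prop :=
  ContDiff ℝ 1 ψ ∧ HasCompactSupport ψ ∧ tsupport ψ ⊆ Ω ∧ ∀ x, ‖ψ x‖ ≤ 1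

/-- The total variation `|Du|(Ω) = sup_ψ ∫_Ω u div ψ`, as an extended nonnegative real. -/
def totalVariation {d : ℕ} (u : EuclideanSpace ℝ (Fin d) → ℝ)
    (Ω : Set (EuclideanSpace ℝ (Fin d))) : ℝ≥0∞ :=
  ⨆ (ψ : EuclideanSpace ℝ (Fin d) → EuclideanSpace ℝ (Fin d)) (_ : IsTestField Ω ψ),
    ENNReal.ofReal (∫ x in Ω, u x * divergence ψ x)

/-- `u ∈ BV(Ω)`: integrable over `Ω`, of finite total variation in `Ω`. -/
def MemBV {d : ℕ} (u : EuclideanSpace ℝ (Fin d) → ℝ)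
    (Ω : Set (EuclideanSpace ℝ (Fin d))) : Prop :=
  IntegrableOn u Ω volume ∧ totalVariation u Ω < ∞

/-- The norm `‖u‖_{L¹(Ω)} + |Du|(Ω)` of `BV(Ω)`. -/
def bvNorm {d : ℕ} (u : EuclideanSpace ℝ (Fin d) → ℝ)
    (Ω : Set (EuclideanSpace ℝ (Fin d))) : ℝ≥0∞ :=
  eLpNorm u 1 (volume.restrict Ω) + totalVariation u Ω

/-- `f` restricts to a `C¹` diffeomorphism of `Ω` onto `Ω`, with inverse `g`. -/
structure IsDiffeoOn {d : ℕ} (Ω : Set (EuclideanSpace ℝ (Fin d)))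
    (f g : EuclideanSpace ℝ (Fin d) → EuclideanSpace ℝ (Fin d)) : Prop where
  mapsTo : MapsTo f Ω Ω
  mapsTo_inv : MapsTo g Ω Ω
  invOn : InvOn g f Ω Ω
  contDiffOn : ContDiffOn ℝ 1 f Ω
  contDiffOn_inv : ContDiffOn ℝ 1 g Ω

end

/-! Extend `u` by zero and mollify to get smooth `w n`. By duality, on compact sets whose thickening
stays in `Ω`, the integral of `|∇w n|` is at most `|Du|(Ω)`
(`lintegral_fderiv_convolution_le_totalVariation`). The curve `s ↦ Φ s x` is compact in `Ω`, so for
large `n` the difference of `w n` at its ends is at most the speed bound times the integral of `|∇w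
n|` along it. Integrating in `x`, Tonelli and a change of variables at each fixed `s` cost only the
factor `c`; Fatou then passes to `u`. -/

section BVDeformation

open Filter Topology Metric ContinuousLinearMap
open scoped Convolution

section Mollification

variable {E F : Type*} [NormedAddCommGroup E] [InnerProductSpace ℝ E] [FiniteDimensional ℝ E]
  [MeasurableSpace E] [BorelSpace E] [NormedAddCommGroup F] [NormedSpace ℝ F]

theorem integrable_fderiv_apply_smul {ρ : E → ℝ} (hρ : ContDiff ℝ 1 ρ) (hρc : HasCompactSupport ρ)
    {v : E → F} (hv : Integrable v) (x : E) :
    Integrable (fun t => (fderiv ℝ ρ (x - t)).smulRight (v t)) := by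
  have hc : Continuous (fderiv ℝ ρ) := hρ.continuous_fderiv one_ne_zero
  obtain ⟨M, hM⟩ := (hρc.fderiv (𝕜 := ℝ)).exists_bound_of_continuous hc
  refine (hv.norm.const_mul M).mono' ?_ (Eventually.of_forall fun t => ?_)
  · have := (ContinuousLinearMap.smulRightL ℝ E F).aestronglyMeasurable_comp₂
      (μ := volume) (f := fun t => fderiv ℝ ρ (x - t)) (g := v)
      (hc.comp (continuous_const.sub continuous_id)).aestronglyMeasurable
      hv.aestronglyMeasurable
    exact this
  · rw [ContinuousLinearMap.norm_smulRight_apply]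
    exact mul_le_mul_of_nonneg_right (hM _) (norm_nonneg _)

theorem hasFDerivAt_convolution_smul [CompleteSpace F] {ρ : E → ℝ} (hρ : ContDiff ℝ 1 ρ)
    (hρc : HasCompactSupport ρ) {v : E → F} (hv : Integrable v) (x : E) :
    HasFDerivAt (ρ ⋆[lsmul ℝ ℝ] v) (∫ t, (fderiv ℝ ρ (x - t)).smulRight (v t)) x := by
  have h := hρc.hasFDerivAt_convolution_left (μ := volume) (lsmul ℝ ℝ (E := F)) hρ
    hv.locallyIntegrable x
  rw [convolution_eq_swap] at h
  exact h

theorem fderiv_convolution_smul_apply [CompleteSpace F] {ρ : E → ℝ} (hρ : ContDiff ℝ 1 ρ)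
    (hρc : HasCompactSupport ρ) {v : E → F} (hv : Integrable v) (x w : E) :
    fderiv ℝ (ρ ⋆[lsmul ℝ ℝ] v) x w = ∫ t, fderiv ℝ ρ (x - t) w • v t := by
  rw [(hasFDerivAt_convolution_smul hρ hρc hv x).fderiv,
    ContinuousLinearMap.integral_apply (integrable_fderiv_apply_smul hρ hρc hv x)]
  rfl

theorem norm_convolution_le_of_norm_le {ρ : E → ℝ} (hρ : Integrable ρ) (hρ0 : ∀ x, 0 ≤ ρ x)
    (hρ1 : ∫ x, ρ x = 1) {v : E → F} (hv : ∀ x, ‖v x‖ ≤ 1) (x : E) :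
    ‖(ρ ⋆[lsmul ℝ ℝ] v) x‖ ≤ 1 := by
  rw [← hρ1]
  refine norm_integral_le_of_norm_le hρ (Eventually.of_forall fun t => ?_)
  rw [lsmul_apply, norm_smul, Real.norm_of_nonneg (hρ0 t)]
  exact mul_le_of_le_one_right (hρ0 t) (hv _)

theorem tsupport_convolution_subset_cthickening {ρ : E → ℝ} {ε : ℝ}
    (hρ : Function.support ρ ⊆ ball 0 ε) {v : E → F} {K : Set E} (hv : Function.support v ⊆ K) :
    tsupport (ρ ⋆[lsmul ℝ ℝ] v) ⊆ cthickening ε K := by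
  refine closure_minimal ?_ isClosed_cthickening
  refine (support_convolution_subset _).trans ?_
  rintro _ ⟨a, ha, b, hb, rfl⟩
  refine mem_cthickening_of_dist_le _ b _ _ (hv hb) ?_
  have := mem_ball_zero_iff.1 (hρ ha)
  simpa using this.le

end Mollification

/-! ### Duality between mollified gradients and total variation -/

section Divergence

variable {d : ℕ}

local notation "𝔼" d:max => EuclideanSpace ℝ (Fin d)

/-- All derivatives fall on `ρ`, so the field need only be integrable; this admits a discontinuous
one below. -/
theorem divergence_convolution {ρ : 𝔼 d → ℝ} (hρ : ContDiff ℝ 1 ρ)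
    (hρc : HasCompactSupport ρ) {ψ : 𝔼 d → 𝔼 d} (hψ : Integrable ψ) (y : 𝔼 d) :
    divergence (ρ ⋆[lsmul ℝ ℝ] ψ) y = ∫ t, fderiv ℝ ρ (y - t) (ψ t) := by
  have hi := integrable_fderiv_apply_smul hρ hρc hψ y
  have hi' (w : 𝔼 d) : Integrable (fun t => fderiv ℝ ρ (y - t) w • ψ t) :=
    hi.apply_continuousLinearMap w
  have hi'' (i : Fin d) : Integrable
      (fun t => (fderiv ℝ ρ (y - t) (EuclideanSpace.single i 1) • ψ t) i) :=
    (EuclideanSpace.proj (𝕜 := ℝ) i).integrable_comp (hi' _)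
  unfold divergence
  simp_rw [fderiv_convolution_smul_apply hρ hρc hψ]
  have h1 (i : Fin d) : (∫ t, fderiv ℝ ρ (y - t) (EuclideanSpace.single i 1) • ψ t) i
      = ∫ t, (fderiv ℝ ρ (y - t) (EuclideanSpace.single i 1) • ψ t) i :=
    ((EuclideanSpace.proj (𝕜 := ℝ) i).integral_comp_comm (hi' _)).symm
  simp_rw [h1]
  rw [← integral_finsetSum _ fun i _ => hi'' i]
  refine integral_congr_ae (Eventually.of_forall fun t => ?_)
  have h2 : ψ t = ∑ i, (ψ t i) • EuclideanSpace.single i (1 : ℝ) := by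
    simpa using ((EuclideanSpace.basisFun (Fin d) ℝ).sum_repr (ψ t)).symm
  simp only
  conv_rhs => rw [h2]
  simp [map_sum, mul_comm]

theorem fderiv_neg_of_even {E : Type*} [NormedAddCommGroup E] [NormedSpace ℝ E] {ρ : E → ℝ}
    (hd : Differentiable ℝ ρ) (he : ∀ x, ρ (-x) = ρ x) (x : E) : fderiv ℝ ρ (-x) = -fderiv ℝ ρ x := by
  have h := (hd (-x)).hasFDerivAt.comp x (hasFDerivAt_id x).neg
  rw [show ρ ∘ Neg.neg = ρ from funext he] at h
  ext w
  simp [h.fderiv]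

/-- Moving a mollifier from the field to the function turns the divergence into a derivative. -/
theorem integral_mul_divergence_convolution {ρ : 𝔼 d → ℝ} (hρ : ContDiff ℝ 1 ρ)
    (hρc : HasCompactSupport ρ) (he : ∀ x, ρ (-x) = ρ x) {v : 𝔼 d → ℝ} (hv : Integrable v)
    {ψ : 𝔼 d → 𝔼 d} (hψ : Integrable ψ) :
    ∫ y, v y * divergence (ρ ⋆[lsmul ℝ ℝ] ψ) y =
      -∫ x, fderiv ℝ (ρ ⋆[lsmul ℝ ℝ] v) x (ψ x) := by
  have hc : Continuous (fderiv ℝ ρ) := hρ.continuous_fderiv one_ne_zero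
  obtain ⟨M, hM⟩ := (hρc.fderiv (𝕜 := ℝ)).exists_bound_of_continuous hc
  have hint : Integrable (fun p : 𝔼 d × 𝔼 d => v p.1 * fderiv ℝ ρ (p.1 - p.2) (ψ p.2))
      (volume.prod volume) := by
    refine ((hv.norm.mul_prod hψ.norm).const_mul M).mono' ?_ (Eventually.of_forall fun p => ?_)
    · refine hv.aestronglyMeasurable.comp_fst.mul ?_
      have := (ContinuousLinearMap.apply ℝ ℝ (E := 𝔼 d)).aestronglyMeasurable_comp₂
        (μ := (volume : Measure (𝔼 d)).prod volume) (f := fun p : 𝔼 d × 𝔼 d => ψ p.2)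
        (g := fun p => fderiv ℝ ρ (p.1 - p.2)) hψ.aestronglyMeasurable.comp_snd
        (hc.comp (continuous_fst.sub continuous_snd)).aestronglyMeasurable
      exact this
    · rw [norm_mul]
      calc ‖v p.1‖ * ‖fderiv ℝ ρ (p.1 - p.2) (ψ p.2)‖ ≤ ‖v p.1‖ * (M * ‖ψ p.2‖) := by
            gcongr
            exact ContinuousLinearMap.le_of_opNorm_le _ (hM _) _
        _ = M * (‖v p.1‖ * ‖ψ p.2‖) := by ring
  simp_rw [divergence_convolution hρ hρc hψ, ← integral_const_mul]
  rw [integral_integral_swap hint, ← integral_neg]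
  refine integral_congr_ae (Eventually.of_forall fun x => ?_)
  simp only
  rw [fderiv_convolution_smul_apply hρ hρc hv, ← integral_neg]
  refine integral_congr_ae (Eventually.of_forall fun y => ?_)
  simp only
  rw [← neg_sub x y, fderiv_neg_of_even (hρ.differentiable one_ne_zero) he]
  simp [mul_comm]

/-- The gradient of a mollification has, over a compact set that stays inside `Ω` after
thickening, at most the mass of the total variation. -/
theorem lintegral_fderiv_convolution_le_totalVariation {Ω : Set (𝔼 d)} (hΩ : IsOpen Ω)
    {u : 𝔼 d → ℝ} (hu : IntegrableOn u Ω) {K : Set (𝔼 d)} (hK : IsCompact K)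
    (ρ : ContDiffBump (0 : 𝔼 d)) (hKρ : cthickening ρ.rOut K ⊆ Ω) :
    ∫⁻ x in K, ‖fderiv ℝ (ρ.normed volume ⋆[lsmul ℝ ℝ] Ω.indicator u) x‖ₑ ≤
      totalVariation u Ω := by
  set r := ρ.normed (volume : Measure (𝔼 d)) with hr
  set v := Ω.indicator u
  have hv : Integrable v := hu.integrable_indicator hΩ.measurableSet
  have hr1 : ContDiff ℝ 1 r := ρ.contDiff_normed (n := 1)
  have hrc : HasCompactSupport r := ρ.hasCompactSupport_normed
  have hD : Continuous (fderiv ℝ (r ⋆[lsmul ℝ ℝ] v)) :=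
    (hrc.contDiff_convolution_left (n := 1) _ hr1 hv.locallyIntegrable).continuous_fderiv
      one_ne_zero
  set G : 𝔼 d → 𝔼 d := fun x => (InnerProductSpace.toDual ℝ (𝔼 d)).symm
    (fderiv ℝ (r ⋆[lsmul ℝ ℝ] v) x) with hG
  have hGc : Continuous G := (LinearIsometryEquiv.continuous _).comp hD
  have hGn (x) : ‖G x‖ = ‖fderiv ℝ (r ⋆[lsmul ℝ ℝ] v) x‖ := LinearIsometryEquiv.norm_map _ _
  have hGa (x) : fderiv ℝ (r ⋆[lsmul ℝ ℝ] v) x (G x) = ‖G x‖ * ‖G x‖ := by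
    rw [← real_inner_self_eq_norm_mul_norm, hG, InnerProductSpace.toDual_symm_apply]
  -- The extremal dual field, the negative unit gradient cut off to `K`. It is not continuous, but
  -- its mollification is a test field. Where the gradient vanishes, `0⁻¹ = 0` makes it zero.
  set ψ : 𝔼 d → 𝔼 d := K.indicator fun x => -(‖G x‖⁻¹ • G x) with hψ
  have hψ1 (x) : ‖ψ x‖ ≤ 1 := by
    refine (norm_indicator_le_norm_self _ _).trans ?_
    rw [norm_neg, norm_smul, norm_inv, norm_norm]
    exact inv_mul_le_one
  have hψi : Integrable ψ := by
    refine Integrable.mono' (g := K.indicator fun _ => (1 : ℝ)) ?_ ?_ ?_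
    · exact (integrableOn_const hK.measure_lt_top.ne).integrable_indicator hK.measurableSet
    · exact ((hGc.measurable.norm.inv.smul hGc.measurable).neg.indicator
        hK.measurableSet).aestronglyMeasurable
    · refine Eventually.of_forall fun x => ?_
      by_cases hx : x ∈ K
      · simpa [hx] using hψ1 x
      · simp [hψ, hx]
  have hsub : tsupport (r ⋆[lsmul ℝ ℝ] ψ) ⊆ cthickening ρ.rOut K :=
    tsupport_convolution_subset_cthickening ρ.support_normed_eq.subset
      Set.support_indicator_subset
  have htest : IsTestField Ω (r ⋆[lsmul ℝ ℝ] ψ) :=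
    ⟨hrc.contDiff_convolution_left (n := 1) _ hr1 hψi.locallyIntegrable,
      hK.cthickening.of_isClosed_subset (isClosed_tsupport _) hsub, hsub.trans hKρ,
      norm_convolution_le_of_norm_le ρ.integrable_normed ρ.nonneg_normed ρ.integral_normed hψ1⟩
  have key : ∫ x in Ω, u x * divergence (r ⋆[lsmul ℝ ℝ] ψ) x =
      ∫ x in K, ‖fderiv ℝ (r ⋆[lsmul ℝ ℝ] v) x‖ := by
    have h1 : ∫ x in Ω, u x * divergence (r ⋆[lsmul ℝ ℝ] ψ) x =
        ∫ x, v x * divergence (r ⋆[lsmul ℝ ℝ] ψ) x := by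
      rw [← integral_indicator hΩ.measurableSet]
      refine integral_congr_ae (Eventually.of_forall fun x => ?_)
      by_cases hx : x ∈ Ω <;> simp [v, hx]
    rw [h1, integral_mul_divergence_convolution hr1 hrc ρ.normed_neg hv hψi, ← integral_neg,
      ← integral_indicator hK.measurableSet]
    refine integral_congr_ae (Eventually.of_forall fun x => ?_)
    by_cases hx : x ∈ K
    · simp only [hψ, indicator_of_mem hx, map_neg, map_smul, neg_neg, hGa, ← hGn, smul_eq_mul]
      by_cases h0 : ‖G x‖ = 0
      · simp [h0]
      · field_simp
    · simp [hψ, hx]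
  calc ∫⁻ x in K, ‖fderiv ℝ (r ⋆[lsmul ℝ ℝ] v) x‖ₑ
      = ENNReal.ofReal (∫ x in K, ‖fderiv ℝ (r ⋆[lsmul ℝ ℝ] v) x‖) := by
        rw [ofReal_integral_norm_eq_lintegral_enorm]
        exact hD.continuousOn.integrableOn_compact hK
    _ = ENNReal.ofReal (∫ x in Ω, u x * divergence (r ⋆[lsmul ℝ ℝ] ψ) x) := by rw [key]
    _ ≤ totalVariation u Ω := le_iSup₂_of_le _ htest le_rfl

end Divergence

/-! ### Change of variables along one diffeomorphism -/

section ChangeOfVariables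

variable {d : ℕ} {Ω : Set (EuclideanSpace ℝ (Fin d))}
  {f g : EuclideanSpace ℝ (Fin d) → EuclideanSpace ℝ (Fin d)} {c : ℝ≥0}

theorem IsDiffeoOn.lintegral_comp_le (h : IsDiffeoOn Ω f g) (hΩ : IsOpen Ω)
    (hdet : ∀ x ∈ Ω, |(fderiv ℝ g x).det| ≤ (c : ℝ)) (k : EuclideanSpace ℝ (Fin d) → ℝ≥0∞) :
    ∫⁻ x in Ω, k (f x) ≤ c * ∫⁻ x in Ω, k x := by
  have himg : g '' Ω = Ω := by
    refine (image_subset_iff.2 h.mapsTo_inv).antisymm fun x hx => ?_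
    exact ⟨f x, h.mapsTo hx, h.invOn.1 hx⟩
  have hg (x) (hx : x ∈ Ω) : HasFDerivWithinAt g (fderiv ℝ g x) Ω x :=
    ((h.contDiffOn_inv.differentiableOn one_ne_zero).differentiableAt
      (hΩ.mem_nhds hx)).hasFDerivAt.hasFDerivWithinAt
  have key := lintegral_image_eq_lintegral_abs_det_fderiv_mul volume hΩ.measurableSet hg
    h.invOn.2.injOn (fun x => k (f x))
  rw [himg] at key
  rw [key, ← lintegral_const_mul' _ _ ENNReal.coe_ne_top]
  refine setLIntegral_mono' hΩ.measurableSet fun x hx => ?_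
  rw [h.invOn.2 hx]
  gcongr
  rw [ENNReal.ofReal_le_iff_le_toReal ENNReal.coe_ne_top]
  exact hdet x hx

theorem IsDiffeoOn.aemeasurable (h : IsDiffeoOn Ω f g) (hΩ : IsOpen Ω) :
    AEMeasurable f (volume.restrict Ω) :=
  h.contDiffOn.continuousOn.aemeasurable hΩ.measurableSet

/-- Preimages of null sets are null, so almost everywhere convergence survives composition with `f`.
-/
theorem IsDiffeoOn.map_absolutelyContinuous (h : IsDiffeoOn Ω f g) (hΩ : IsOpen Ω)
    (hdet : ∀ x ∈ Ω, |(fderiv ℝ g x).det| ≤ (c : ℝ)) :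
    (volume.restrict Ω).map f ≪ volume.restrict Ω := by
  refine Measure.AbsolutelyContinuous.mk fun s hs h0 => ?_
  have := h.lintegral_comp_le hΩ hdet (s.indicator 1)
  rw [lintegral_indicator_one hs, h0, mul_zero,
    ← lintegral_map' ((measurable_one.indicator hs).aemeasurable) (h.aemeasurable hΩ),
    lintegral_indicator_one hs] at this
  exact le_antisymm this bot_le

end ChangeOfVariables

/-- The velocity of `γ` need not be continuous or measurable; it suffices that the derivative of `w
∘ γ` has a continuous majorant. Bounding the product rather than the speed also covers a vanishing
gradient with unbounded speed. -/
theorem enorm_sub_le_lintegral_fderiv_along {E : Type*} [NormedAddCommGroup E] [NormedSpace ℝ E]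
    {w : E → ℝ} (hw : ContDiff ℝ 1 w) {γ : ℝ → E} (hγ : DifferentiableOn ℝ γ (Icc 0 1)) {L : ℝ≥0}
    (hL : ∀ s ∈ Icc (0 : ℝ) 1,
      ‖fderiv ℝ w (γ s) (derivWithin γ (Icc 0 1) s)‖ ≤ L * ‖fderiv ℝ w (γ s)‖) :
    ‖w (γ 0) - w (γ 1)‖ₑ ≤ ∫⁻ s in Icc (0 : ℝ) 1, L * ‖fderiv ℝ w (γ s)‖ₑ := by
  have hB : ContinuousOn (fun s => L * ‖fderiv ℝ w (γ s)‖) (Icc (0 : ℝ) 1) :=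
    continuousOn_const.mul
      ((hw.continuous_fderiv one_ne_zero).comp_continuousOn hγ.continuousOn).norm
  have hd (s) (hs : s ∈ Ioo (0 : ℝ) 1) :
      HasDerivAt (fun s => w (γ s)) (fderiv ℝ w (γ s) (derivWithin γ (Icc 0 1) s)) s := by
    have h1 := (hγ s (Ioo_subset_Icc_self hs)).hasDerivWithinAt.hasDerivAt
      (Icc_mem_nhds hs.1 hs.2)
    exact (hw.differentiable one_ne_zero (γ s)).hasFDerivAt.comp_hasDerivAt s h1
  have key := norm_sub_le_integral_of_norm_deriv_le_of_le (f := fun s => w (γ s))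
    (B := fun s => L * ‖fderiv ℝ w (γ s)‖) zero_le_one
    (hw.continuous.comp_continuousOn hγ.continuousOn)
    (fun s hs => (hd s hs).differentiableAt.differentiableWithinAt)
    (Eventually.of_forall fun s hs => by
      rw [(hd s hs).deriv]; exact hL s (Ioo_subset_Icc_self hs))
    (hB.intervalIntegrable_of_Icc zero_le_one)
  rw [intervalIntegral.integral_of_le zero_le_one, ← integral_Icc_eq_integral_Ioc] at key
  rw [← enorm_neg, neg_sub, ← ofReal_norm]
  refine (ENNReal.ofReal_le_ofReal key).trans_eq ?_
  rw [ofReal_integral_eq_lintegral_ofReal (hB.integrableOn_compact isCompact_Icc)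
    (Eventually.of_forall fun s => by positivity)]
  refine lintegral_congr fun s => ?_
  rw [ENNReal.ofReal_mul L.coe_nonneg, ofReal_norm, ENNReal.ofReal_coe_nnreal]

theorem IsOpen.exists_compact_exhaustion {X : Type*} [TopologicalSpace X] [LocallyCompactSpace X]
    [SecondCountableTopology X] {Ω : Set X} (hΩ : IsOpen Ω) :
    ∃ K : ℕ → Set X, (∀ n, IsCompact (K n)) ∧ (∀ n, K n ⊆ Ω) ∧
      ∀ P, IsCompact P → P ⊆ Ω → ∀ᶠ n in atTop, P ⊆ interior (K n) := by
  have := hΩ.locallyCompactSpace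
  let T : CompactExhaustion Ω := CompactExhaustion.choice Ω
  refine ⟨fun n => (↑) '' T n, fun n => (T.isCompact n).image continuous_subtype_val,
    fun n => Subtype.coe_image_subset _ _, fun P hP hPΩ => ?_⟩
  have hP' : IsCompact ((↑) ⁻¹' P : Set Ω) :=
    Topology.IsInducing.subtypeVal.isCompact_preimage_iff (by simpa using hPΩ) |>.2 hP
  obtain ⟨m, hm⟩ := T.exists_superset_of_isCompact hP'
  filter_upwards [eventually_gt_atTop m] with n hn x hx
  have hx' : (⟨x, hPΩ hx⟩ : Ω) ∈ interior (T n) := T.subset_interior hn (hm hx)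
  exact hΩ.isOpenMap_subtype_val.image_interior_subset _ ⟨_, hx', rfl⟩

/-- A Carathéodory argument: continuity in `s` and measurability in `x` give joint measurability,
once `s` is clamped to `[0,1]` and the map is set to zero off `Ω`. Tonelli needs this. -/
theorem aemeasurable_comp_uncurry {E β : Type*} [NormedAddCommGroup E] [MeasurableSpace E]
    [BorelSpace E] [MeasurableSpace β] {μ : Measure E} [SFinite μ] {Ω : Set E}
    (hΩ : MeasurableSet Ω) {Φ : ℝ → E → E}
    (hs : ∀ s ∈ Icc (0 : ℝ) 1, ContinuousOn (Φ s) Ω)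
    (hx : ∀ x ∈ Ω, ContinuousOn (fun s => Φ s x) (Icc 0 1)) {k : E → β} (hk : Measurable k) :
    AEMeasurable (fun p : E × ℝ => k (Φ p.2 p.1))
      ((μ.restrict Ω).prod (volume.restrict (Icc 0 1))) := by
  classical
  let F : ℝ → E → E := fun s => Ω.indicator (Φ (projIcc 0 1 zero_le_one s))
  have hF : Measurable (Function.uncurry F) := by
    refine measurable_uncurry_of_continuous_of_measurable (fun x => ?_) fun s => ?_
    · by_cases h : x ∈ Ω
      · simpa [F, h] using! (hx x h).domRestrict.comp continuous_projIcc
      · simpa [F, h] using continuous_const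
    · exact (hs _ (Subtype.coe_prop _)).measurable_piecewise continuousOn_const hΩ
  refine ⟨fun p => k (F p.2 p.1), hk.comp (hF.comp measurable_swap), ?_⟩
  rw [Measure.prod_restrict]
  filter_upwards [ae_restrict_mem (hΩ.prod measurableSet_Icc)] with p hp
  simp [F, hp.1, projIcc_of_mem zero_le_one hp.2]

/-! ### The deformation estimate -/

section Deformation

variable {d : ℕ} {Ω : Set (EuclideanSpace ℝ (Fin d))} {u : EuclideanSpace ℝ (Fin d) → ℝ}

/-- Deforming the argument of a `BV` function along a family of diffeomorphisms of speed at most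
`L`. When the total variation vanishes no bound on the speed is needed. -/
theorem lintegral_enorm_sub_comp_le (hΩ : IsOpen Ω) (hu : IntegrableOn u Ω)
    {Φ Ψ : ℝ → EuclideanSpace ℝ (Fin d) → EuclideanSpace ℝ (Fin d)}
    (hdiffeo : ∀ s ∈ Icc (0 : ℝ) 1, IsDiffeoOn Ω (Φ s) (Ψ s))
    (hdiff : ∀ x ∈ Ω, DifferentiableOn ℝ (fun s => Φ s x) (Icc (0 : ℝ) 1)) {c L : ℝ≥0}
    (hdet : ∀ s ∈ Icc (0 : ℝ) 1, ∀ x ∈ Ω, |(fderiv ℝ (Ψ s) x).det| ≤ (c : ℝ))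
    (hL : totalVariation u Ω = 0 ∨ ∀ s ∈ Icc (0 : ℝ) 1, ∀ x ∈ Ω,
      ‖derivWithin (fun t => Φ t x) (Icc (0 : ℝ) 1) s‖ ≤ L) :
    ∫⁻ x in Ω, ‖u (Φ 0 x) - u (Φ 1 x)‖ₑ ≤ c * (L * totalVariation u Ω) := by
  obtain ⟨K, hKc, hKΩ, hK⟩ := hΩ.exists_compact_exhaustion
  choose δ hδ0 hδ using fun n => (hKc n).exists_cthickening_subset_open hΩ (hKΩ n)
  have hr0 (n : ℕ) : 0 < min (δ n) (1 / (n + 1 : ℝ)) := lt_min (hδ0 n) (by positivity)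
  let ρ (n : ℕ) : ContDiffBump (0 : EuclideanSpace ℝ (Fin d)) :=
    ⟨min (δ n) (1 / (n + 1 : ℝ)) / 2, min (δ n) (1 / (n + 1 : ℝ)), half_pos (hr0 n),
      half_lt_self (hr0 n)⟩
  have hρ0 : Tendsto (fun n => (ρ n).rOut) atTop (𝓝 0) :=
    squeeze_zero (fun n => (hr0 n).le) (fun n => min_le_right _ _)
      tendsto_one_div_add_atTop_nhds_zero_nat
  have hv : Integrable (Ω.indicator u) := hu.integrable_indicator hΩ.measurableSet
  let w (n : ℕ) := (ρ n).normed volume ⋆[lsmul ℝ ℝ] Ω.indicator u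
  have hw (n) : ContDiff ℝ 1 (w n) := (ρ n).hasCompactSupport_normed.contDiff_convolution_left
    (n := 1) _ ((ρ n).contDiff_normed (n := 1)) hv.locallyIntegrable
  have hDw (n) : Continuous (fderiv ℝ (w n)) := (hw n).continuous_fderiv one_ne_zero
  let g (n : ℕ) : EuclideanSpace ℝ (Fin d) → ℝ≥0∞ :=
    (K n).indicator fun x => ‖fderiv ℝ (w n) x‖ₑ
  have hgm (n) : Measurable (g n) :=
    (hDw n).measurable.enorm.indicator (hKc n).measurableSet
  have hgi (n) : ∫⁻ x, g n x ≤ totalVariation u Ω := by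
    rw [lintegral_indicator (hKc n).measurableSet]
    exact lintegral_fderiv_convolution_le_totalVariation hΩ hu (hKc n) (ρ n)
      ((cthickening_mono (min_le_left _ _) _).trans (hδ n))
  -- Vanishing almost everywhere would say nothing along a single curve; continuity upgrades it to
  -- every point.
  have hzero (h0 : totalVariation u Ω = 0) (n) : ∀ x ∈ interior (K n), fderiv ℝ (w n) x = 0 := by
    have h1 : ∫⁻ x in interior (K n), ‖fderiv ℝ (w n) x‖ₑ = 0 := by
      refine le_antisymm ?_ bot_le
      refine (lintegral_mono_set interior_subset).trans ?_
      rw [← lintegral_indicator (hKc n).measurableSet]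
      exact (hgi n).trans_eq h0
    rw [lintegral_eq_zero_iff (hDw n).measurable.enorm] at h1
    refine Measure.eqOn_open_of_ae_eq (μ := volume) (g := 0) ?_ isOpen_interior (hDw n).continuousOn
      continuousOn_const
    filter_upwards [h1] with x hx
    rwa [← ofReal_norm, Pi.zero_apply, ENNReal.ofReal_eq_zero, norm_le_zero_iff] at hx
  have hconv : ∀ᵐ x ∂volume.restrict Ω, Tendsto (fun n => w n x) atTop (𝓝 (u x)) := by
    have := ContDiffBump.ae_convolution_tendsto_right_of_locallyIntegrable (μ := volume)
      (K := 2) hρ0 (Eventually.of_forall fun n => by simp only [ρ]; linarith) hv.locallyIntegrable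
    filter_upwards [ae_restrict_of_ae this, ae_restrict_mem hΩ.measurableSet] with x hx hxΩ
    simpa [hxΩ] using hx
  have hconvΦ (s) (hs : s ∈ Icc (0 : ℝ) 1) : ∀ᵐ x ∂volume.restrict Ω,
      Tendsto (fun n => w n (Φ s x)) atTop (𝓝 (u (Φ s x))) :=
    ae_of_ae_map ((hdiffeo s hs).aemeasurable hΩ)
      (((hdiffeo s hs).map_absolutelyContinuous hΩ (hdet s hs)).ae_le hconv)
  have hmeas (n) : AEMeasurable (fun p : EuclideanSpace ℝ (Fin d) × ℝ => L * g n (Φ p.2 p.1))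
      ((volume.restrict Ω).prod (volume.restrict (Icc 0 1))) :=
    (aemeasurable_comp_uncurry hΩ.measurableSet
      (fun s hs => (hdiffeo s hs).contDiffOn.continuousOn)
      (fun x hx => (hdiff x hx).continuousOn) (hgm n)).const_mul _
  have hpath (x) (hx : x ∈ Ω) : ∀ᶠ n in atTop,
      ‖w n (Φ 0 x) - w n (Φ 1 x)‖ₑ ≤ ∫⁻ s in Icc (0 : ℝ) 1, L * g n (Φ s x) := by
    filter_upwards [hK ((fun s => Φ s x) '' Icc 0 1) (isCompact_Icc.image_of_continuousOn
      (hdiff x hx).continuousOn) (image_subset_iff.2 fun s hs => (hdiffeo s hs).mapsTo hx)]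
      with n hn
    have hin (s) (hs : s ∈ Icc (0 : ℝ) 1) : Φ s x ∈ interior (K n) := hn (mem_image_of_mem _ hs)
    refine (enorm_sub_le_lintegral_fderiv_along (hw n) (hdiff x hx) (L := L)
      fun s hs => ?_).trans_eq ?_
    · rcases hL with h0 | hL
      · simp [hzero h0 n _ (hin s hs)]
      · rw [mul_comm]
        exact ContinuousLinearMap.le_opNorm_of_le _ (hL s hs x hx)
    · refine setLIntegral_congr_fun measurableSet_Icc fun s hs => ?_
      simp only [g, indicator_of_mem (interior_subset (hin s hs))]
  have hbound (n) : ∫⁻ x in Ω, ∫⁻ s in Icc (0 : ℝ) 1, L * g n (Φ s x) ≤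
      c * (L * totalVariation u Ω) := by
    rw [lintegral_lintegral_swap (hmeas n)]
    calc ∫⁻ s in Icc (0 : ℝ) 1, ∫⁻ x in Ω, L * g n (Φ s x)
        ≤ ∫⁻ s in Icc (0 : ℝ) 1, c * (L * totalVariation u Ω) := by
          refine setLIntegral_mono' measurableSet_Icc fun s hs => ?_
          refine ((hdiffeo s hs).lintegral_comp_le hΩ (hdet s hs) (fun x => L * g n x)).trans ?_
          rw [lintegral_const_mul' _ _ ENNReal.coe_ne_top]
          gcongr
          exact (setLIntegral_le_lintegral _ _).trans (hgi n)
      _ = c * (L * totalVariation u Ω) := by simp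
  -- The threshold in `hpath` depends on `x`, so the pointwise bounds are compared only through
  -- their `liminf`.
  calc ∫⁻ x in Ω, ‖u (Φ 0 x) - u (Φ 1 x)‖ₑ
      ≤ ∫⁻ x in Ω, liminf (fun n => ∫⁻ s in Icc (0 : ℝ) 1, L * g n (Φ s x)) atTop := by
        refine lintegral_mono_ae ?_
        filter_upwards [hconvΦ 0 (by simp), hconvΦ 1 (by simp),
          ae_restrict_mem hΩ.measurableSet] with x h0 h1 hx
        rw [← ((h0.sub h1).enorm).liminf_eq]
        exact liminf_le_liminf (hpath x hx)
    _ ≤ liminf (fun n => ∫⁻ x in Ω, ∫⁻ s in Icc (0 : ℝ) 1, L * g n (Φ s x)) atTop :=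
        lintegral_liminf_le' fun n => (hmeas n).lintegral_prod_right'
    _ ≤ c * (L * totalVariation u Ω) := liminf_le_of_le (by isBoundedDefault)
        fun b hb => (hb.exists.choose_spec).trans (hbound _)

theorem IsDiffeoOn.memLp_comp {f g : EuclideanSpace ℝ (Fin d) → EuclideanSpace ℝ (Fin d)}
    {c : ℝ≥0} (h : IsDiffeoOn Ω f g) (hΩ : IsOpen Ω)
    (hdet : ∀ x ∈ Ω, |(fderiv ℝ g x).det| ≤ (c : ℝ)) (hu : IntegrableOn u Ω) :
    MemLp (fun x => u (f x)) 1 (volume.restrict Ω) := by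
  refine memLp_one_iff_integrable.2 ⟨?_, ?_⟩
  · exact (hu.aestronglyMeasurable.mono_ac
      (h.map_absolutelyContinuous hΩ hdet)).comp_aemeasurable (h.aemeasurable hΩ)
  · exact (h.lintegral_comp_le hΩ hdet (fun x => ‖u x‖ₑ)).trans_lt
      (ENNReal.mul_lt_top ENNReal.coe_lt_top hu.2)

end Deformation

end BVDeformation

theorem mainTheorem5 {d : ℕ} (Ω : Set (EuclideanSpace ℝ (Fin d))) (hΩ : IsOpen Ω)
    (u : EuclideanSpace ℝ (Fin d) → ℝ) (hu : MemBV u Ω)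
    (φ₀ φ₁ : EuclideanSpace ℝ (Fin d) → EuclideanSpace ℝ (Fin d))
    (Φ Ψ : ℝ → EuclideanSpace ℝ (Fin d) → EuclideanSpace ℝ (Fin d))
    (hΦ₀ : ∀ x ∈ Ω, Φ 0 x = φ₀ x) (hΦ₁ : ∀ x ∈ Ω, Φ 1 x = φ₁ x)
    (hdiffeo : ∀ s ∈ Icc (0 : ℝ) 1, IsDiffeoOn Ω (Φ s) (Ψ s))
    (hdiff : ∀ x ∈ Ω, DifferentiableOn ℝ (fun s => Φ s x) (Icc (0 : ℝ) 1))
    (c C : ℝ≥0)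
    (hdet : ∀ s ∈ Icc (0 : ℝ) 1, ∀ x ∈ Ω, |(fderiv ℝ (Ψ s) x).det| ≤ (c : ℝ))
    (hspeed : ∀ s ∈ Icc (0 : ℝ) 1, ∀ x ∈ Ω,
      ‖derivWithin (fun t => Φ t x) (Icc (0 : ℝ) 1) s‖ₑ ≤
        (C : ℝ≥0∞) * eLpNorm (fun x => φ₀ x - φ₁ x) ∞ (volume.restrict Ω)) :
    MemLp (fun x => u (φ₀ x) - u (φ₁ x)) 1 (volume.restrict Ω) ∧
    eLpNorm (fun x => u (φ₀ x) - u (φ₁ x)) 1 (volume.restrict Ω) ≤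
      (c : ℝ≥0∞) * C * totalVariation u Ω *
        eLpNorm (fun x => φ₀ x - φ₁ x) ∞ (volume.restrict Ω) ∧
    eLpNorm (fun x => u (φ₀ x) - u (φ₁ x)) 1 (volume.restrict Ω) ≤
      (c : ℝ≥0∞) * C * bvNorm u Ω *
        eLpNorm (fun x => φ₀ x - φ₁ x) ∞ (volume.restrict Ω) := by
  have h0 : (0 : ℝ) ∈ Icc (0 : ℝ) 1 := by simp
  have h1 : (1 : ℝ) ∈ Icc (0 : ℝ) 1 := by simp
  have hcongr : (fun x => u (φ₀ x) - u (φ₁ x)) =ᵐ[volume.restrict Ω]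
      fun x => u (Φ 0 x) - u (Φ 1 x) := by
    filter_upwards [ae_restrict_mem hΩ.measurableSet] with x hx
    rw [hΦ₀ x hx, hΦ₁ x hx]
  have hmem : MemLp (fun x => u (Φ 0 x) - u (Φ 1 x)) 1 (volume.restrict Ω) :=
    ((hdiffeo 0 h0).memLp_comp hΩ (hdet 0 h0) hu.1).sub
      ((hdiffeo 1 h1).memLp_comp hΩ (hdet 1 h1) hu.1)
  have hmain : eLpNorm (fun x => u (φ₀ x) - u (φ₁ x)) 1 (volume.restrict Ω) ≤
      (c : ℝ≥0∞) * C * totalVariation u Ω *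
        eLpNorm (fun x => φ₀ x - φ₁ x) ∞ (volume.restrict Ω) := by
    rw [eLpNorm_congr_ae hcongr, eLpNorm_one_eq_lintegral_enorm]
    set N := eLpNorm (fun x => φ₀ x - φ₁ x) ∞ (volume.restrict Ω)
    -- With an infinite speed bound, `0 * ∞ = 0` leaves two real cases: zero variation, where `L =
    -- 0` is allowed, and `c = 0`, where both compositions have zero integral. Otherwise the right
    -- side is infinite.
    by_cases hfin : (C : ℝ≥0∞) * N = ∞
    · rcases eq_or_ne (totalVariation u Ω) 0 with hTV | hTV
      · have := lintegral_enorm_sub_comp_le (L := 0) hΩ hu.1 hdiffeo hdiff hdet (Or.inl hTV)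
        simpa [hTV] using this
      · rcases eq_or_ne c 0 with rfl | hc
        · have hz (s) (hs : s ∈ Icc (0 : ℝ) 1) : ∫⁻ x in Ω, ‖u (Φ s x)‖ₑ = 0 := by
            simpa using (hdiffeo s hs).lintegral_comp_le hΩ (hdet s hs) (fun x => ‖u x‖ₑ)
          have hle : ∫⁻ x in Ω, ‖u (Φ 0 x) - u (Φ 1 x)‖ₑ ≤
              ∫⁻ x in Ω, (‖u (Φ 0 x)‖ₑ + ‖u (Φ 1 x)‖ₑ) := lintegral_mono fun x => enorm_sub_le
          rw [lintegral_add_left' ((hdiffeo 0 h0).memLp_comp hΩ (hdet 0 h0)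
            hu.1).aestronglyMeasurable.enorm, hz 0 h0, hz 1 h1, add_zero] at hle
          exact hle.trans bot_le
        · have : (c : ℝ≥0∞) * C * totalVariation u Ω * N =
              c * totalVariation u Ω * (C * N) := by ring
          rw [this, hfin, ENNReal.mul_top (mul_ne_zero (by simpa using hc) hTV)]
          exact le_top
    · have hL : ((C * N).toNNReal : ℝ≥0∞) = C * N := ENNReal.coe_toNNReal hfin
      have := lintegral_enorm_sub_comp_le (L := (C * N).toNNReal) hΩ hu.1 hdiffeo hdiff hdet
        (Or.inr fun s hs x hx => by
          have := hspeed s hs x hx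
          rw [← hL] at this
          exact_mod_cast enorm_le_coe.1 this)
      rw [hL] at this
      exact this.trans_eq (by ring)
  refine ⟨hmem.ae_eq hcongr.symm, hmain, hmain.trans ?_⟩
  gcongr
  exact le_add_self
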